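/- Let $G$ be a finite group, let $H,K$ be subgroups of $G$, and let $A$ be a normal subgroup of $G$ contained in $H$. Write $N_G(X)$ for the normalizer in $G$ of a subgroup $X$, and put $D=K\cap A$. Suppose that (i) $K\unlhd H\unlhd N_G(D)$; (ii) $H/K$ is cyclic and is a maximal abelian subgroup of $N_G(K)/K$ (that is, maximal under inclusion among the abelian subgroups of $N_G(K)/K$). For a subgroup $X$ of $G$ let $\widehat X=\frac1{|X|}\sum_{x\in X}x\in\mathbb{Q}G$. Let $\varepsilon(H,K)=\widehat K$ if $H=K$, and otherwise let $\varepsilon(H,K)=\prod_L(\widehat K-\widehat L)$, where $L$ runs over the minimal elements of the set of normal subgroups of $H$ that contain $K$ properly. Let $e(G,H,K)$ be the sum of all the distinct $G$-conjugates $g^{-1}\varepsilon(H,K)g$ ($g\in G$) of $\varepsilon(H,K)$. Then $(H,K)$ is a strong Shoda pair of $G$, that is, (a) $K\unlhd H\unlhd N_G(K)$; (b) $H/K$ is cyclic and is a maximal abelian subgroup of $N_G(K)/K$; (c) the distinct $G$-conjugates of $\varepsilon(H,K)$ are mutually orthogonal (the product of any two different ones is $0$). Moreover, $e(G,H,K)$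 is a primitive central idempotent of $\mathbb{Q}G$, that is, a nonzero central idempotent that is not the sum of two nonzero orthogonal central idempotents of $\mathbb{Q}G$. -/

import Mathlib

/-- `NormalIn K H`: the subgroup `K` of `G` is contained in the subgroup `H` and normal in it. -/
def NormalIn {G : Type*} [Group G] (K H : Subgroup G) : Prop :=
  K ≤ H ∧ (K.subgroupOf H).Normal

/-- The normalizer `N_G(K)`, as a subgroup of `G`. -/
abbrev normalizerOf {G : Type*} [Group G] (K : Subgroup G) : Subgroup G :=
  Subgroup.normalizer (K : Set G)

/-- The image of `H` in `N_G(K)/K`; for `K ⊴ H` this is the subgroup `H/K` of `N_G(K)/K`. -/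
def quotInNormalizer {G : Type*} [Group G] (H K : Subgroup G) :
    Subgroup (normalizerOf K ⧸ K.subgroupOf (normalizerOf K)) :=
  (H.subgroupOf (normalizerOf K)).map (QuotientGroup.mk' (K.subgroupOf (normalizerOf K)))

/-- `B` is a maximal abelian subgroup of `Q`: it is maximal, for inclusion, among the abelian
subgroups of `Q`. -/
def IsMaximalAbelian {Q : Type*} [Group Q] (B : Subgroup Q) : Prop :=
  Maximal (fun C : Subgroup Q => ∀ x ∈ C, ∀ y ∈ C, x * y = y * x) B

noncomputable section

/-- The element `Ĥ = (1/|H|) ∑_{h ∈ H} h` of `ℚG`. -/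
def hatElem {G : Type*} [Group G] [Finite G] (H : Subgroup G) : MonoidAlgebra ℚ G :=
  (1 / (Nat.card H : ℚ)) • ∑ h ∈ (Set.toFinite (H : Set G)).toFinset, MonoidAlgebra.of ℚ G h

/-- The minimal elements among the normal subgroups `L` of `H` that contain `K` properly. -/
def minimalNormalOver {G : Type*} [Group G] (H K : Subgroup G) : Set (Subgroup G) :=
  {L | Minimal (fun M : Subgroup G => NormalIn M H ∧ K < M) L}

theorem hatElem_commute_of {G : Type*} [Group G] [Finite G] {H L : Subgroup G}
    (hL : NormalIn L H) {g : G} (hg : g ∈ H) :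
    Commute (hatElem L) (MonoidAlgebra.of ℚ G g) := by
  have hc : ∀ x ∈ H, ∀ h ∈ L, x * h * x⁻¹ ∈ L := by
    intro x hx h hh
    have := hL.2.conj_mem ⟨h, hL.1 hh⟩ (Subgroup.mem_subgroupOf.2 hh) ⟨x, hx⟩
    simpa [Subgroup.mem_subgroupOf] using this
  unfold hatElem
  refine Commute.smul_left ?_ _
  rw [commute_iff_eq, Finset.sum_mul, Finset.mul_sum]
  simp only [← map_mul]
  refine Finset.sum_bij' (fun h _ => g⁻¹ * h * g) (fun h _ => g * h * g⁻¹) ?_ ?_ ?_ ?_ ?_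
  · intro h hh
    have := hc g⁻¹ (H.inv_mem hg) h (by simpa using hh)
    simpa using this
  · intro h hh
    have := hc g hg h (by simpa using hh)
    simpa using this
  · intro h _; group
  · intro h _; group
  · intro h _; congr 1; group

theorem hatElem_commute {G : Type*} [Group G] [Finite G] {H L M : Subgroup G}
    (hL : NormalIn L H) (hM : M ≤ H) : Commute (hatElem L) (hatElem M) := by
  conv => arg 2; unfold hatElem
  refine Commute.smul_right ?_ _
  refine Commute.sum_right _ _ _ fun h hh => ?_
  exact hatElem_commute_of hL (hM (by simpa using hh))

theorem epsilonFactors_commute {G : Type*} [Group G] [Finite G] (H K : Subgroup G) :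
    ((Set.toFinite (minimalNormalOver H K)).toFinset : Set (Subgroup G)).Pairwise
      (Function.onFun Commute fun L => hatElem K - hatElem L) := by
  intro L hL M hM _
  have hL' : NormalIn L H ∧ K < L := ((Set.Finite.mem_toFinset _).1 hL).1
  have hM' : NormalIn M H ∧ K < M := ((Set.Finite.mem_toFinset _).1 hM).1
  have hK : K ≤ H := hL'.2.le.trans hL'.1.1
  exact ((Commute.refl _).sub_right (hatElem_commute hM'.1 hK).symm).sub_left
    ((hatElem_commute hL'.1 hK).sub_right (hatElem_commute hL'.1 hM'.1.1))

open Classical in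
/-- `ε(H,K)`, for `K ⊴ H`: it is `K̂` if `H = K`, and otherwise the product of the (commuting)
elements `K̂ - L̂`, where `L` runs over the minimal normal subgroups of `H` containing `K`
properly. -/
def epsilonElem {G : Type*} [Group G] [Finite G] (H K : Subgroup G) : MonoidAlgebra ℚ G :=
  if H = K then hatElem K
  else (Set.toFinite (minimalNormalOver H K)).toFinset.noncommProd
    (fun L => hatElem K - hatElem L) (epsilonFactors_commute H K)

/-- The set of the `G`-conjugates `g⁻¹ x g` of an element `x` of `ℚG`. -/
def conjugatesIn {G : Type*} [Group G] (x : MonoidAlgebra ℚ G) : Set (MonoidAlgebra ℚ G) :=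
  Set.range fun g : G => MonoidAlgebra.of ℚ G g⁻¹ * x * MonoidAlgebra.of ℚ G g

theorem conjugatesIn_finite {G : Type*} [Group G] [Finite G] (x : MonoidAlgebra ℚ G) :
    (conjugatesIn x).Finite :=
  Set.finite_range _

/-- `e(G,H,K)`, the sum of all the distinct `G`-conjugates of `ε(H,K)`. -/
def eElem {G : Type*} [Group G] [Finite G] (H K : Subgroup G) : MonoidAlgebra ℚ G :=
  ∑ x ∈ (conjugatesIn_finite (epsilonElem H K)).toFinset, x

end

/-- A strong Shoda pair `(H,K)` of the finite group `G`. -/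
structure IsStrongShodaPair {G : Type*} [Group G] [Finite G] (H K : Subgroup G) : Prop where
  normal_left : NormalIn K H
  normal_right : NormalIn H (normalizerOf K)
  cyclic : IsCyclic (quotInNormalizer H K)
  maximalAbelian : IsMaximalAbelian (quotInNormalizer H K)
  orthogonal : (conjugatesIn (epsilonElem H K)).Pairwise fun x y => x * y = 0

/-- A primitive central idempotent of a ring: a nonzero central idempotent that is not the sum of
two nonzero orthogonal central idempotents. -/
structure IsPrimitiveCentralIdempotent {R : Type*} [Ring R] (e : R) : Prop where
  ne_zero : e ≠ 0
  idem : IsIdempotentElem e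
  central : e ∈ Subring.center R
  primitive : ∀ f g : R, IsIdempotentElem f → f ∈ Subring.center R → IsIdempotentElem g →
    g ∈ Subring.center R → f * g = 0 → f + g = e → f = 0 ∨ g = 0

/-! Write ε for ε(H,K). As H/K is cyclic, K is the kernel of a character χ of H. Everything rests on
`eq_zero_of_fixed_of_notMem`: an element of εℚG fixed by some u in H \ K is zero, because its
stabilizer contains some minimal L over K, and ε kills L̂.

Orthogonality: N_G(K) ≤ N_G(D) ≤ N_G(H), so elements of N_G(K) commute with ε. If g is not in
N_G(K), then (i) gives k in K with gkg⁻¹ in H \ K (`exists_conj_mem_notMem`); this element fixes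
εgε, hence εgε = 0.

Primitivity: for central f, averaging hεfεh⁻¹ over H puts fε in the span of Hε. Elements outside
N_G(K) contribute nothing by orthogonality; those of N_G(K) outside H contribute nothing because H/K
is maximal abelian (`epsilonTrace_of_mem_epsilonSpan`). That span is a quotient of ℚ[X]/(Φ_n), n =
|H/K|, so its only idempotents are 0 and ε (`eq_zero_or_eq_epsilonElem_of_idempotent`). Hence a
central summand f of e has fε = 0 or fε = ε, and conjugation carries this over to all of e. -/

/-! ### Conjugation of subgroups. -/

theorem Subgroup.map_conj_map_conj_inv {G : Type*} [Group G] (L : Subgroup G) (g : G) :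
    (L.map (MulAut.conj g⁻¹).toMonoidHom).map (MulAut.conj g).toMonoidHom = L := by
  rw [Subgroup.map_map]
  convert Subgroup.map_id L
  ext
  simp [mul_assoc]

theorem Subgroup.map_conj_inv_map_conj {G : Type*} [Group G] (L : Subgroup G) (g : G) :
    (L.map (MulAut.conj g).toMonoidHom).map (MulAut.conj g⁻¹).toMonoidHom = L := by
  simpa using L.map_conj_map_conj_inv g⁻¹

theorem normalIn_refl {G : Type*} [Group G] (H : Subgroup G) : NormalIn H H :=
  ⟨le_rfl, by rw [Subgroup.subgroupOf_self]; infer_instance⟩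

theorem NormalIn.map_equiv {G : Type*} [Group G] {H K : Subgroup G} (h : NormalIn K H)
    (σ : G ≃* G) : NormalIn (K.map σ.toMonoidHom) (H.map σ.toMonoidHom) := by
  refine ⟨Subgroup.map_mono h.1, ⟨?_⟩⟩
  rintro ⟨_, y, hy, rfl⟩ hn ⟨_, x, hx, rfl⟩
  obtain ⟨z, hz, e⟩ := hn
  obtain rfl : z = y := σ.injective e
  have := h.2.conj_mem ⟨z, hy⟩ hz ⟨x, hx⟩
  exact ⟨x * z * x⁻¹, this, by simp [-Subgroup.subtype_apply]; rfl⟩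

theorem map_conj_mem_minimalNormalOver {G : Type*} [Group G] {H K L : Subgroup G} {g : G}
    (hH : H.map (MulAut.conj g).toMonoidHom = H) (hK : K.map (MulAut.conj g).toMonoidHom = K)
    (hL : L ∈ minimalNormalOver H K) :
    L.map (MulAut.conj g).toMonoidHom ∈ minimalNormalOver H K := by
  have inv : ∀ {X : Subgroup G}, X.map (MulAut.conj g).toMonoidHom = X →
      X.map (MulAut.conj g⁻¹).toMonoidHom = X := by
    intro X h
    conv_lhs => rw [← h]
    exact X.map_conj_inv_map_conj g
  have aux : ∀ {g : G}, H.map (MulAut.conj g).toMonoidHom = H →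
      K.map (MulAut.conj g).toMonoidHom = K → ∀ {M : Subgroup G}, NormalIn M H ∧ K < M →
      NormalIn (M.map (MulAut.conj g).toMonoidHom) H ∧ K < M.map (MulAut.conj g).toMonoidHom := by
    intro g hH hK M hM
    refine ⟨hH ▸ hM.1.map_equiv (MulAut.conj g), ?_⟩
    conv_lhs => rw [← hK]
    exact (Subgroup.map_lt_map_iff_of_injective (MulAut.conj g).injective).2 hM.2
  refine ⟨aux hH hK hL.1, fun M hM hle => ?_⟩
  have h1 := hL.2 (aux (inv hH) (inv hK) hM)
    ((Subgroup.map_mono hle).trans (L.map_conj_inv_map_conj g).le)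
  exact (Subgroup.map_mono h1).trans (M.map_conj_map_conj_inv g).le

/-! ### The averaging idempotents L̂. -/

section HatElem

variable {G : Type*} [Group G] [Finite G]

theorem of_mul_hatElem {L : Subgroup G} {u : G} (hu : u ∈ L) :
    MonoidAlgebra.of ℚ G u * hatElem L = hatElem L := by
  unfold hatElem
  rw [mul_smul_comm, Finset.mul_sum]
  congr 1
  refine Finset.sum_equiv (Equiv.mulLeft u) (fun i => ?_) (fun i _ => ?_)
  · simp [Subgroup.mul_mem_cancel_left L hu]
  · simp [← map_mul, -MonoidAlgebra.of_apply]

/-- A general linear map serves both multiplication in ℚG and evaluation in a representation. -/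
theorem LinearMap.map_hatElem_of_const {V : Type*} [AddCommGroup V] [Module ℚ V]
    (Λ : MonoidAlgebra ℚ G →ₗ[ℚ] V) {L : Subgroup G} {y : V}
    (h : ∀ l ∈ L, Λ (MonoidAlgebra.of ℚ G l) = y) : Λ (hatElem L) = y := by
  unfold hatElem
  rw [map_smul, map_sum, Finset.sum_congr rfl (g := fun _ => y), Finset.sum_const]
  · have hc : ((Set.toFinite (L : Set G)).toFinset).card = Nat.card L := by
      rw [← Set.ncard_eq_toFinset_card]; rfl
    have : (Nat.card L : ℚ) ≠ 0 := by exact_mod_cast Nat.card_pos.ne'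
    rw [hc, ← Nat.cast_smul_eq_nsmul ℚ, smul_smul, one_div, inv_mul_cancel₀ this, one_smul]
  · intro l hl
    exact h l (by simpa using hl)

theorem hatElem_mul_eq_of_fixed {L : Subgroup G} {y : MonoidAlgebra ℚ G}
    (h : ∀ l ∈ L, MonoidAlgebra.of ℚ G l * y = y) : hatElem L * y = y :=
  (LinearMap.mulRight ℚ y).map_hatElem_of_const h

theorem hatElem_mul_hatElem_of_le {L M : Subgroup G} (h : L ≤ M) :
    hatElem L * hatElem M = hatElem M :=
  hatElem_mul_eq_of_fixed fun _ hl => of_mul_hatElem (h hl)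

theorem hatElem_map_conj (L : Subgroup G) (g : G) :
    hatElem (L.map (MulAut.conj g).toMonoidHom) =
      MonoidAlgebra.of ℚ G g * hatElem L * MonoidAlgebra.of ℚ G g⁻¹ := by
  unfold hatElem
  rw [mul_smul_comm, smul_mul_assoc, Finset.mul_sum, Finset.sum_mul,
    Subgroup.card_map_of_injective (MulAut.conj g).injective]
  congr 1
  symm
  refine Finset.sum_equiv (MulAut.conj g).toEquiv (fun i => ?_) (fun i _ => ?_)
  · simp
  · simp [← map_mul, -MonoidAlgebra.of_apply]

theorem hatElem_mul_of_conj (L : Subgroup G) (g : G) (y : MonoidAlgebra ℚ G) :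
    hatElem (L.map (MulAut.conj g).toMonoidHom) * (MonoidAlgebra.of ℚ G g * y) =
      MonoidAlgebra.of ℚ G g * (hatElem L * y) := by
  have : MonoidAlgebra.of ℚ G g⁻¹ * MonoidAlgebra.of ℚ G g = 1 := by
    rw [← map_mul, inv_mul_cancel, map_one]
  rw [hatElem_map_conj]
  simp only [mul_assoc]
  rw [← mul_assoc (MonoidAlgebra.of ℚ G g⁻¹), this, one_mul]

theorem mul_of_hatElem_conj (L : Subgroup G) (g : G) (y : MonoidAlgebra ℚ G) :
    y * MonoidAlgebra.of ℚ G g⁻¹ * hatElem (L.map (MulAut.conj g).toMonoidHom) =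
      y * hatElem L * MonoidAlgebra.of ℚ G g⁻¹ := by
  have : MonoidAlgebra.of ℚ G g⁻¹ * MonoidAlgebra.of ℚ G g = 1 := by
    rw [← map_mul, inv_mul_cancel, map_one]
  rw [hatElem_map_conj]
  simp only [mul_assoc]
  rw [← mul_assoc (MonoidAlgebra.of ℚ G g⁻¹), this, one_mul]

end HatElem

/-! ### Algebra of ε(H,K). -/

section Epsilon

variable {G : Type*} [Group G] [Finite G] {H K L M : Subgroup G}

theorem exists_minimalNormalOver_le (hM : NormalIn M H) (hKM : K < M) :
    ∃ L ∈ minimalNormalOver H K, L ≤ M := by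
  obtain ⟨L, hL, hm⟩ := exists_minimal_le_of_wellFoundedLT
    (fun M : Subgroup G => NormalIn M H ∧ K < M) M ⟨hM, hKM⟩
  exact ⟨L, hm, hL⟩

open Classical in
-- The factors commute, so any one of them can be moved to either end.
theorem epsilonElem_eq_mul (hL : L ∈ minimalNormalOver H K) :
    ∃ r, epsilonElem H K = (hatElem K - hatElem L) * r ∧
      epsilonElem H K = r * (hatElem K - hatElem L) := by
  have hne : H ≠ K := by
    rintro rfl
    exact absurd hL.1.1.1 hL.1.2.not_ge
  have hmem : L ∈ (Set.toFinite (minimalNormalOver H K)).toFinset := by simpa using hL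
  unfold epsilonElem
  rw [if_neg hne]
  exact ⟨_, (Finset.mul_noncommProd_erase _ hmem _ _).symm,
    (Finset.noncommProd_erase_mul _ hmem _ _).symm⟩

theorem epsilonElem_induction (p : MonoidAlgebra ℚ G → Prop) (hK : p (hatElem K))
    (hone : p 1) (hmul : ∀ a b, p a → p b → p (a * b))
    (hL : ∀ L ∈ minimalNormalOver H K, p (hatElem K - hatElem L)) :
    p (epsilonElem H K) := by
  unfold epsilonElem
  split_ifs with h
  · exact hK
  · exact Finset.noncommProd_induction _ _ _ p hmul hone fun L h => hL L (by simpa using h)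

theorem hatElem_mul_hatElem_of_minimal (hL : L ∈ minimalNormalOver H K) :
    hatElem L * hatElem K = hatElem L := by
  rw [(hatElem_commute hL.1.1 (hL.1.2.le.trans hL.1.1.1)).eq, hatElem_mul_hatElem_of_le hL.1.2.le]

theorem hatElem_mul_epsilonElem (hKH : NormalIn K H) :
    hatElem K * epsilonElem H K = epsilonElem H K := by
  by_cases h : H = K
  · rw [epsilonElem, if_pos h, hatElem_mul_hatElem_of_le le_rfl]
  · obtain ⟨L, hL, -⟩ := exists_minimalNormalOver_le (normalIn_refl H)
      (lt_of_le_of_ne hKH.1 (Ne.symm h))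
    obtain ⟨r, hr, -⟩ := epsilonElem_eq_mul hL
    rw [hr, ← mul_assoc, mul_sub, hatElem_mul_hatElem_of_le le_rfl,
      hatElem_mul_hatElem_of_le hL.1.2.le]

theorem epsilonElem_mul_hatElem (hKH : NormalIn K H) :
    epsilonElem H K * hatElem K = epsilonElem H K := by
  by_cases h : H = K
  · rw [epsilonElem, if_pos h, hatElem_mul_hatElem_of_le le_rfl]
  · obtain ⟨L, hL, -⟩ := exists_minimalNormalOver_le (normalIn_refl H)
      (lt_of_le_of_ne hKH.1 (Ne.symm h))
    obtain ⟨r, -, hr⟩ := epsilonElem_eq_mul hL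
    rw [hr, mul_assoc, sub_mul, hatElem_mul_hatElem_of_le le_rfl,
      hatElem_mul_hatElem_of_minimal hL]

theorem hatElem_mul_epsilonElem_of_minimal (hL : L ∈ minimalNormalOver H K) :
    hatElem L * epsilonElem H K = 0 := by
  obtain ⟨r, hr, -⟩ := epsilonElem_eq_mul hL
  rw [hr, ← mul_assoc, mul_sub, hatElem_mul_hatElem_of_minimal hL,
    hatElem_mul_hatElem_of_le le_rfl, sub_self, zero_mul]

theorem epsilonElem_mul_hatElem_of_minimal (hL : L ∈ minimalNormalOver H K) :
    epsilonElem H K * hatElem L = 0 := by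
  obtain ⟨r, -, hr⟩ := epsilonElem_eq_mul hL
  rw [hr, mul_assoc, sub_mul, hatElem_mul_hatElem_of_le hL.1.2.le,
    hatElem_mul_hatElem_of_le le_rfl, sub_self, mul_zero]

/-- Each factor K̂ - L̂ acts on y as the identity. This recognizes elements of εℚG without expanding
the product. -/
theorem epsilonElem_mul_eq {y : MonoidAlgebra ℚ G} (hK : hatElem K * y = y)
    (hL : ∀ L ∈ minimalNormalOver H K, hatElem L * y = 0) : epsilonElem H K * y = y :=
  epsilonElem_induction (fun x => x * y = y) hK (one_mul y)
    (fun a b ha hb => by rw [mul_assoc, hb, ha])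
    (fun L h => by rw [sub_mul, hK, hL L h, sub_zero])

theorem mul_epsilonElem_eq {y : MonoidAlgebra ℚ G} (hK : y * hatElem K = y)
    (hL : ∀ L ∈ minimalNormalOver H K, y * hatElem L = 0) : y * epsilonElem H K = y :=
  epsilonElem_induction (fun x => y * x = y) hK (mul_one y)
    (fun a b ha hb => by rw [← mul_assoc, ha, hb])
    (fun L h => by rw [mul_sub, hK, hL L h, sub_zero])

theorem epsilonElem_mul_self (hKH : NormalIn K H) :
    epsilonElem H K * epsilonElem H K = epsilonElem H K :=
  epsilonElem_mul_eq (hatElem_mul_epsilonElem hKH) fun _ => hatElem_mul_epsilonElem_of_minimal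

theorem of_mul_epsilonElem (hKH : NormalIn K H) {k : G} (hk : k ∈ K) :
    MonoidAlgebra.of ℚ G k * epsilonElem H K = epsilonElem H K := by
  rw [← hatElem_mul_epsilonElem hKH, ← mul_assoc, of_mul_hatElem hk]

theorem epsilonElem_mul_of (hKH : NormalIn K H) {k : G} (hk : k ∈ K) :
    epsilonElem H K * MonoidAlgebra.of ℚ G k = epsilonElem H K := by
  rw [← epsilonElem_mul_hatElem hKH, mul_assoc, (hatElem_commute_of hKH (hKH.1 hk)).eq,
    of_mul_hatElem hk]

/-- Conjugation by g permutes the minimal L, so gε and εg are both equal to εgε. -/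
theorem of_commute_epsilonElem (hKH : NormalIn K H) {g : G} (hgH : g ∈ normalizerOf H)
    (hgK : g ∈ normalizerOf K) :
    Commute (MonoidAlgebra.of ℚ G g) (epsilonElem H K) := by
  have hKi : K.map (MulAut.conj g).toMonoidHom = K := Subgroup.mem_normalizer_iff_map_conj_eq.1 hgK
  have hHi : H.map (MulAut.conj g).toMonoidHom = H := Subgroup.mem_normalizer_iff_map_conj_eq.1 hgH
  have hKi' : K.map (MulAut.conj g⁻¹).toMonoidHom = K :=
    Subgroup.mem_normalizer_iff_map_conj_eq.1 (inv_mem hgK)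
  have hHi' : H.map (MulAut.conj g⁻¹).toMonoidHom = H :=
    Subgroup.mem_normalizer_iff_map_conj_eq.1 (inv_mem hgH)
  have h1 : epsilonElem H K * (MonoidAlgebra.of ℚ G g * epsilonElem H K) =
      MonoidAlgebra.of ℚ G g * epsilonElem H K := by
    refine epsilonElem_mul_eq ?_ fun L hL => ?_
    · have := hatElem_mul_of_conj K g (epsilonElem H K)
      rwa [hKi, hatElem_mul_epsilonElem hKH] at this
    · rw [← L.map_conj_map_conj_inv g, hatElem_mul_of_conj, hatElem_mul_epsilonElem_of_minimal
        (map_conj_mem_minimalNormalOver hHi' hKi' hL), mul_zero]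
  have h2 : epsilonElem H K * MonoidAlgebra.of ℚ G g * epsilonElem H K =
      epsilonElem H K * MonoidAlgebra.of ℚ G g := by
    have key : ∀ L : Subgroup G, epsilonElem H K * MonoidAlgebra.of ℚ G g * hatElem L =
        epsilonElem H K * hatElem (L.map (MulAut.conj g).toMonoidHom) *
          MonoidAlgebra.of ℚ G g := by
      intro L
      have := mul_of_hatElem_conj (L.map (MulAut.conj g).toMonoidHom) g⁻¹ (epsilonElem H K)
      rwa [inv_inv, L.map_conj_inv_map_conj] at this
    refine mul_epsilonElem_eq ?_ fun L hL => ?_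
    · rw [key, hKi, epsilonElem_mul_hatElem hKH]
    · rw [key, epsilonElem_mul_hatElem_of_minimal (map_conj_mem_minimalNormalOver hHi hKi hL),
        zero_mul]
  rw [commute_iff_eq, ← h1, ← mul_assoc, h2]

end Epsilon

/-! ### Consequences of a character of H with kernel K. -/

theorem commutator_mem_of_character {G : Type*} [Group G] {H K : Subgroup G} {χ : H →* ℂˣ}
    (hχ : ∀ h, χ h = 1 ↔ (h : G) ∈ K) {x y : G}
    (hx : x ∈ H) (hy : y ∈ H) : (x * y)⁻¹ * (y * x) ∈ K := by
  refine (hχ ((⟨x, hx⟩ * ⟨y, hy⟩)⁻¹ * (⟨y, hy⟩ * ⟨x, hx⟩))).1 ?_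
  simp only [map_mul, map_inv]
  rw [mul_comm (χ ⟨y, hy⟩), inv_mul_cancel]

theorem normalIn_of_character {G : Type*} [Group G] {H K : Subgroup G} {χ : H →* ℂˣ}
    (hχ : ∀ h, χ h = 1 ↔ (h : G) ∈ K)
    {M : Subgroup G} (hKM : K ≤ M) (hMH : M ≤ H) : NormalIn M H := by
  refine ⟨hMH, ⟨fun m hm h => ?_⟩⟩
  have h4 := hKM (commutator_mem_of_character hχ (H.inv_mem m.2) (H.inv_mem h.2))
  have e : (h : G) * m * (h : G)⁻¹ = ((m : G)⁻¹ * (h : G)⁻¹)⁻¹ * ((h : G)⁻¹ * (m : G)⁻¹) * m := by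
    group
  rw [Subgroup.mem_subgroupOf]
  exact (congrArg (· ∈ M) e).mpr (M.mul_mem h4 hm)

section FaithfulCharacter

variable {G : Type*} [Group G] [Finite G] {H K : Subgroup G}

theorem of_mul_epsilonElem_eq_of_inv_mul_mem (hKH : NormalIn K H) {x y : G} (h : x⁻¹ * y ∈ K) :
    MonoidAlgebra.of ℚ G x * epsilonElem H K = MonoidAlgebra.of ℚ G y * epsilonElem H K := by
  rw [← mul_inv_cancel_left x y, map_mul, mul_assoc, of_mul_epsilonElem hKH h]

/-- The stabilizer S of a contains K and u. Since H/K is abelian, ⟨K, u⟩ is normal in H and so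
contains a minimal L; then a = εa = εL̂a = 0. -/
theorem eq_zero_of_fixed_of_notMem {χ : H →* ℂˣ} (hχ : ∀ h, χ h = 1 ↔ (h : G) ∈ K)
    (hKH : NormalIn K H) {u : G} (huH : u ∈ H) (huK : u ∉ K) {a : MonoidAlgebra ℚ G}
    (ha : epsilonElem H K * a = a) (hu : MonoidAlgebra.of ℚ G u * a = a) : a = 0 := by
  let S : Subgroup G :=
    { carrier := {g | MonoidAlgebra.of ℚ G g * a = a}
      mul_mem' := fun {x y} hx hy => by
        simp only [Set.mem_ofPred_eq] at *
        rw [map_mul, mul_assoc, hy, hx]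
      one_mem' := by simp only [Set.mem_ofPred_eq, map_one, one_mul]
      inv_mem' := fun {x} hx => by
        simp only [Set.mem_ofPred_eq] at *
        conv_lhs => rw [← hx, ← mul_assoc, ← map_mul, inv_mul_cancel, map_one, one_mul] }
  have hKS : K ≤ S := fun k hk => by
    change _ * _ = _
    rw [← ha, ← mul_assoc, of_mul_epsilonElem hKH hk]
  have huS : Subgroup.zpowers u ≤ S := Subgroup.zpowers_le.2 hu
  have hlt : K < K ⊔ Subgroup.zpowers u :=
    lt_of_le_of_ne le_sup_left fun h =>
      huK (h ▸ (le_sup_right : _ ≤ K ⊔ Subgroup.zpowers u) (Subgroup.mem_zpowers u))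
  obtain ⟨L, hL, hLM⟩ := exists_minimalNormalOver_le
    (normalIn_of_character hχ hlt.le (sup_le hKH.1 (Subgroup.zpowers_le.2 huH))) hlt
  have hLa : hatElem L * a = a :=
    hatElem_mul_eq_of_fixed fun l hl => (sup_le hKS huS) (hLM hl)
  rw [← ha, ← hLa, ← mul_assoc, epsilonElem_mul_hatElem_of_minimal hL, zero_mul]

/-- The left regular action of `G` on the complex functions on `G`. -/
noncomputable def leftTranslation (G : Type*) [Group G] : G →* Module.End ℂ (G → ℂ) where
  toFun g := LinearMap.funLeft ℂ ℂ fun x => g⁻¹ * x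
  map_one' := by ext; simp [LinearMap.funLeft_apply]
  map_mul' x y := by
    ext f z
    simp [LinearMap.funLeft_apply, Module.End.mul_apply, mul_assoc]

open Classical in
-- A nonzero function v on which H acts through χ is fixed by K̂ and killed by every L̂, as χ is
-- nontrivial on L. Hence εv = v.
theorem epsilonElem_ne_zero {χ : H →* ℂˣ} (hχ : ∀ h, χ h = 1 ↔ (h : G) ∈ K)
    (hKH : NormalIn K H) : epsilonElem H K ≠ 0 := by
  let ρ : MonoidAlgebra ℚ G →ₐ[ℚ] Module.End ℂ (G → ℂ) :=
    MonoidAlgebra.lift ℚ _ G (leftTranslation G)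
  -- The inverse compensates the one in left translation, so that u acts on v by χ(u).
  let v : G → ℂ := fun x => if hx : x ∈ H then ((χ ⟨x, hx⟩)⁻¹ : ℂˣ) else 0
  have hρ : ∀ u, ρ (MonoidAlgebra.of ℚ G u) = leftTranslation G u := fun u => by
    simp [ρ]
  have hv : ∀ u (hu : u ∈ H), ρ (MonoidAlgebra.of ℚ G u) v = (χ ⟨u, hu⟩ : ℂ) • v := by
    intro u hu
    rw [hρ]
    ext x
    change v (u⁻¹ * x) = _ * v x
    by_cases hx : x ∈ H
    · have hux : u⁻¹ * x ∈ H := H.mul_mem (H.inv_mem hu) hx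
      simp only [v, dif_pos hx, dif_pos hux]
      have : (⟨u⁻¹ * x, hux⟩ : H) = ⟨u, hu⟩⁻¹ * ⟨x, hx⟩ := rfl
      rw [this, ← Units.val_mul]
      simp
      ring
    · have hux : u⁻¹ * x ∉ H := fun h => hx (by simpa using H.mul_mem hu h)
      simp only [v, dif_neg hx, dif_neg hux, mul_zero]
  have hvK : ρ (hatElem K) v = v :=
    ((LinearMap.applyₗ v).restrictScalars ℚ ∘ₗ ρ.toLinearMap).map_hatElem_of_const (L := K)
      fun k hk => by
      have := hv k (hKH.1 hk)
      rw [(hχ ⟨k, hKH.1 hk⟩).2 hk] at this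
      simpa using this
  have hvL : ∀ L ∈ minimalNormalOver H K, ρ (hatElem L) v = 0 := by
    intro L hL
    obtain ⟨l, hl, hlK⟩ := SetLike.exists_of_lt hL.1.2
    have hlH := hL.1.1.1 hl
    -- L̂l = L̂ and lv = χ(l)v give (χ(l) - 1)L̂v = 0 with χ(l) ≠ 1.
    have h1 : ρ (hatElem L * MonoidAlgebra.of ℚ G l) v = ρ (hatElem L) v := by
      rw [(hatElem_commute_of hL.1.1 hlH).eq, of_mul_hatElem hl]
    rw [map_mul, Module.End.mul_apply, hv l hlH] at h1
    have h4 : (χ ⟨l, hlH⟩ : ℂ) ≠ 1 := fun h => hlK ((hχ ⟨l, hlH⟩).1 (Units.ext h))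
    rw [map_smul, ← sub_eq_zero, ← one_smul ℂ (ρ (hatElem L) v), smul_smul, ← sub_smul,
      mul_one] at h1
    exact (smul_eq_zero.1 h1).resolve_left (sub_ne_zero.2 h4)
  have : ρ (epsilonElem H K) v = v :=
    epsilonElem_induction (fun x => ρ x v = v) hvK (by simp)
      (fun a b ha hb => by rw [map_mul, Module.End.mul_apply, hb, ha])
      (fun L hL => by rw [map_sub, LinearMap.sub_apply, hvK, hvL L hL, sub_zero])
  intro h0
  rw [h0, map_zero, LinearMap.zero_apply] at this
  have := congrFun this 1
  have h1 : (⟨1, H.one_mem⟩ : H) = 1 := rfl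
  simp [v, H.one_mem, h1] at this

theorem exists_character_generator (χ : H →* ℂˣ) :
    ∃ h₀ : H, ∀ h, ∃ i : ℕ, χ h = χ h₀ ^ i := by
  have : Finite χ.range := Finite.of_surjective χ.rangeRestrict χ.rangeRestrict_surjective
  obtain ⟨⟨_, h₀, rfl⟩, hg⟩ := IsCyclic.exists_generator (α := χ.range)
  refine ⟨h₀, fun h => ?_⟩
  obtain ⟨i, hi⟩ := mem_powers_iff_mem_zpowers.2 (hg ⟨χ h, h, rfl⟩)
  exact ⟨i, (congrArg Subtype.val hi).symm⟩

/-- The span of the elements `h ε(H,K)` for `h ∈ H`. -/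
noncomputable def epsilonSpan (H K : Subgroup G) : Submodule ℚ (MonoidAlgebra ℚ G) :=
  Submodule.span ℚ (Set.range fun h : H => MonoidAlgebra.of ℚ G h * epsilonElem H K)

theorem of_commute_epsilonElem_of_mem (hKH : NormalIn K H) {h : G} (hh : h ∈ H) :
    Commute (MonoidAlgebra.of ℚ G h) (epsilonElem H K) := by
  refine of_commute_epsilonElem hKH (Subgroup.le_normalizer hh) ?_
  exact (Subgroup.normal_subgroupOf_iff_le_normalizer hKH.1).1 hKH.2 hh

open Polynomial

theorem aeval_of_commute_epsilonElem (hKH : NormalIn K H) (h₀ : H) (P : ℚ[X]) :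
    Commute (aeval (MonoidAlgebra.of ℚ G h₀) P) (epsilonElem H K) := by
  rw [aeval_eq_sum_range]
  exact Commute.sum_left _ _ _ fun i _ =>
    ((of_commute_epsilonElem_of_mem hKH h₀.2).pow_left i).smul_left _

/-- The element hε depends only on hK, hence only on χ(h), which is a power of χ(h₀). -/
theorem exists_aeval_of_mem_epsilonSpan {χ : H →* ℂˣ} (hχ : ∀ h, χ h = 1 ↔ (h : G) ∈ K)
    (hKH : NormalIn K H) {h₀ : H} (hgen : ∀ h, ∃ i : ℕ, χ h = χ h₀ ^ i) {x : MonoidAlgebra ℚ G}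
    (hx : x ∈ epsilonSpan H K) :
    ∃ P : ℚ[X], x = aeval (MonoidAlgebra.of ℚ G h₀) P * epsilonElem H K := by
  induction hx using Submodule.span_induction with
  | mem x hx =>
    obtain ⟨h, rfl⟩ := hx
    obtain ⟨i, hi⟩ := hgen h
    refine ⟨X ^ i, ?_⟩
    simp only [map_pow, aeval_X]
    rw [← map_pow]
    refine of_mul_epsilonElem_eq_of_inv_mul_mem hKH ?_
    exact (hχ (h⁻¹ * h₀ ^ i)).1 (by simp [hi])
  | zero => exact ⟨0, by simp⟩
  | add x y _ _ hx hy =>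
    obtain ⟨P, rfl⟩ := hx
    obtain ⟨Q, rfl⟩ := hy
    exact ⟨P + Q, by simp [add_mul]⟩
  | smul r x _ hx =>
    obtain ⟨P, rfl⟩ := hx
    exact ⟨r • P, by simp⟩

/-- For a proper divisor d of the order of χ(h₀), Φ_d(h₀) is injective on εℚG: Φ_d divides X^d - 1,
so whatever it kills is fixed by h₀^d, which lies outside K. -/
theorem eq_zero_of_prod_cyclotomic_mul {χ : H →* ℂˣ} (hχ : ∀ h, χ h = 1 ↔ (h : G) ∈ K)
    (hKH : NormalIn K H) (h₀ : H) (s : Finset ℕ)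
    (hs : s ⊆ (orderOf (χ h₀)).properDivisors) {w : MonoidAlgebra ℚ G}
    (hw : epsilonElem H K * w = w)
    (h : aeval (MonoidAlgebra.of ℚ G h₀) (∏ d ∈ s, cyclotomic d ℚ) * w = 0) : w = 0 := by
  induction s using Finset.induction_on with
  | empty => simpa using h
  | insert d s hd ih =>
    rw [Finset.insert_subset_iff] at hs
    refine ih hs.2 ?_
    set w' := aeval (MonoidAlgebra.of ℚ G h₀) (∏ d ∈ s, cyclotomic d ℚ) * w with hw'
    have hε : epsilonElem H K * w' = w' := by
      rw [hw', ← mul_assoc, ← (aeval_of_commute_epsilonElem hKH h₀ _).eq, mul_assoc, hw]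
    rw [Finset.prod_insert hd, map_mul, mul_assoc] at h
    obtain ⟨Q, hQ⟩ := cyclotomic.dvd_X_pow_sub_one d ℚ
    have h2 : aeval (MonoidAlgebra.of ℚ G h₀) (X ^ d - 1 : ℚ[X]) * w' = 0 := by
      rw [hQ, mul_comm, map_mul, mul_assoc, h, mul_zero]
    obtain ⟨hdvd, hlt⟩ := Nat.mem_properDivisors.1 hs.1
    have hd0 : d ≠ 0 := by
      rintro rfl
      exact hlt.ne (Nat.eq_zero_of_zero_dvd hdvd).symm
    refine eq_zero_of_fixed_of_notMem hχ hKH (u := (h₀ ^ d : H)) (h₀ ^ d).2 ?_ hε ?_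
    · rw [← hχ, map_pow]
      exact pow_ne_one_of_lt_orderOf hd0 hlt
    · simp only [map_sub, map_pow, aeval_X, map_one, sub_mul, one_mul] at h2
      rw [Subgroup.coe_pow, map_pow]
      exact sub_eq_zero.1 h2

/-- With n the order of χ(h₀), h₀^n lies in K, so X^n - 1 kills ε; the injective factors Φ_d with d
< n are cancelled. -/
theorem aeval_cyclotomic_mul_epsilonElem {χ : H →* ℂˣ} (hχ : ∀ h, χ h = 1 ↔ (h : G) ∈ K)
    (hKH : NormalIn K H) (h₀ : H) :
    aeval (MonoidAlgebra.of ℚ G h₀) (cyclotomic (orderOf (χ h₀)) ℚ) * epsilonElem H K = 0 := by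
  have hfin : IsOfFinOrder (χ h₀) := χ.isOfFinOrder (isOfFinOrder_of_finite h₀)
  refine eq_zero_of_prod_cyclotomic_mul hχ hKH h₀ _ subset_rfl ?_ ?_
  · rw [← mul_assoc, ← (aeval_of_commute_epsilonElem hKH h₀ _).eq, mul_assoc,
      epsilonElem_mul_self hKH]
  · have hprod := prod_cyclotomic_eq_X_pow_sub_one hfin.orderOf_pos ℚ
    rw [← Nat.cons_self_properDivisors hfin.orderOf_pos.ne', Finset.prod_cons, mul_comm] at hprod
    rw [← mul_assoc, ← map_mul, hprod]
    simp only [map_sub, map_pow, aeval_X, map_one, sub_mul, one_mul]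
    rw [← map_pow, sub_eq_zero, of_mul_epsilonElem hKH]
    exact (hχ (h₀ ^ _)).1 (by rw [map_pow, pow_orderOf_eq_one])

/-- Write x = P(h₀)ε. By irreducibility of Φ_n, either Φ_n divides P and x = 0, or a Bézout relation
inverts x relative to ε, and an invertible idempotent is the identity ε. -/
theorem eq_zero_or_eq_epsilonElem_of_idempotent {χ : H →* ℂˣ}
    (hχ : ∀ h, χ h = 1 ↔ (h : G) ∈ K) (hKH : NormalIn K H) {x : MonoidAlgebra ℚ G}
    (hx : x ∈ epsilonSpan H K) (hxx : x * x = x) : x = 0 ∨ x = epsilonElem H K := by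
  obtain ⟨h₀, hgen⟩ := exists_character_generator χ
  obtain ⟨P, hP⟩ := exists_aeval_of_mem_epsilonSpan hχ hKH hgen hx
  have hfin : IsOfFinOrder (χ h₀) := χ.isOfFinOrder (isOfFinOrder_of_finite h₀)
  have hΦ := aeval_cyclotomic_mul_epsilonElem hχ hKH h₀
  by_cases hd : cyclotomic (orderOf (χ h₀)) ℚ ∣ P
  · left
    obtain ⟨Q, rfl⟩ := hd
    rw [hP, mul_comm, map_mul, mul_assoc, hΦ, mul_zero]
  · right
    obtain ⟨A, B, hAB⟩ :=
      (cyclotomic.irreducible_rat hfin.orderOf_pos).coprime_iff_not_dvd.2 hd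
    have hinv : aeval (MonoidAlgebra.of ℚ G h₀) B * x = epsilonElem H K := by
      have := congrArg (fun R => aeval (MonoidAlgebra.of ℚ G h₀) R * epsilonElem H K) hAB
      simp only [map_add, map_mul, add_mul, map_one, one_mul, mul_assoc, hΦ, mul_zero,
        zero_add, ← hP] at this
      exact this
    have hεx : epsilonElem H K * x = x := by
      rw [hP, ← mul_assoc, ← (aeval_of_commute_epsilonElem hKH h₀ _).eq, mul_assoc,
        epsilonElem_mul_self hKH]
    rw [← hεx]
    nth_rewrite 1 [← hinv]
    rw [mul_assoc, hxx, hinv]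

end FaithfulCharacter

/-! ### Normalizers and the group H/K. -/

theorem mem_normalizerOf_of_forall {G : Type*} [Group G] [Finite G] {K : Subgroup G} {g : G}
    (h : ∀ k ∈ K, g * k * g⁻¹ ∈ K) : g ∈ normalizerOf K := by
  rw [normalizerOf, Subgroup.mem_normalizer_iff_map_conj_eq]
  refine Subgroup.eq_of_le_of_card_ge ?_ ?_
  · rintro _ ⟨k, hk, rfl⟩
    exact h k hk
  · exact (Subgroup.card_map_of_injective (MulAut.conj g).injective).ge

theorem conj_mem_of_mem_normalizerOf {G : Type*} [Group G] {K : Subgroup G} {g k : G}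
    (hg : g ∈ normalizerOf K) (hk : k ∈ K) : g * k * g⁻¹ ∈ K :=
  (Subgroup.mem_normalizer_iff.1 hg k).1 hk

section QuotInNormalizer

variable {G : Type*} [Group G] {H K : Subgroup G}

theorem NormalIn.le_normalizerOf (hKH : NormalIn K H) : H ≤ normalizerOf K :=
  (Subgroup.normal_subgroupOf_iff_le_normalizer hKH.1).1 hKH.2

theorem mk_mem_quotInNormalizer_iff (hKH : K ≤ H) {g : G} (hg : g ∈ normalizerOf K) :
    (QuotientGroup.mk' (K.subgroupOf (normalizerOf K)) ⟨g, hg⟩ ∈ quotInNormalizer H K) ↔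
      g ∈ H := by
  constructor
  · rintro ⟨x, hx, e⟩
    have : x⁻¹ * ⟨g, hg⟩ ∈ K.subgroupOf (normalizerOf K) := QuotientGroup.eq.1 e
    have h2 := H.mul_mem hx (hKH this)
    simpa using h2
  · intro h
    exact ⟨⟨g, hg⟩, h, rfl⟩

/-- H/K is isomorphic to the group of complex roots of unity of the same order. -/
theorem exists_character_of_isCyclic [Finite G] (hKH : NormalIn K H)
    (hcyc : IsCyclic (quotInNormalizer H K)) :
    ∃ χ : H →* ℂˣ, ∀ h, χ h = 1 ↔ (h : G) ∈ K := by
  let ψ : H →* quotInNormalizer H K :=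
    ((QuotientGroup.mk' (K.subgroupOf (normalizerOf K))).comp
      (Subgroup.inclusion hKH.le_normalizerOf)).codRestrict _
      fun h => (mk_mem_quotInNormalizer_iff hKH.1 (hKH.le_normalizerOf h.2)).2 h.2
  have : NeZero (Nat.card (quotInNormalizer H K)) := ⟨Nat.card_pos.ne'⟩
  have hcard : Nat.card (quotInNormalizer H K) =
      Nat.card (rootsOfUnity (Nat.card (quotInNormalizer H K)) ℂ) :=
    (HasEnoughRootsOfUnity.natCard_rootsOfUnity ℂ _).symm
  let e := mulEquivOfCyclicCardEq hcard
  refine ⟨(Subgroup.subtype _).comp (e.toMonoidHom.comp ψ), fun h => ?_⟩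
  have h1 : ((Subgroup.subtype _).comp (e.toMonoidHom.comp ψ)) h = 1 ↔ ψ h = 1 := by
    simp
  rw [h1, ← OneMemClass.coe_eq_one]
  change (QuotientGroup.mk' (K.subgroupOf (normalizerOf K)) _ = 1) ↔ _
  rw [QuotientGroup.mk'_apply, QuotientGroup.eq_one_iff]
  rfl

/-- The class of g centralizes H/K, so together they generate an abelian group, which maximality
forces to be H/K. -/
theorem mem_of_centralizes_mod (hKH : NormalIn K H) (hmax : IsMaximalAbelian (quotInNormalizer H K))
    {g : G} (hg : g ∈ normalizerOf K) (hc : ∀ h ∈ H, g⁻¹ * h * g * h⁻¹ ∈ K) : g ∈ H := by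
  set π := QuotientGroup.mk' (K.subgroupOf (normalizerOf K))
  have hcomm : ∀ b ∈ quotInNormalizer H K, b * π ⟨g, hg⟩ = π ⟨g, hg⟩ * b := by
    rintro _ ⟨x, hx, rfl⟩
    rw [← map_mul, ← map_mul]
    refine (QuotientGroup.eq.2 ?_).symm
    have h1 := hc x hx
    have h2 := conj_mem_of_mem_normalizerOf (inv_mem x.2) h1
    rw [Subgroup.mem_subgroupOf]
    convert h2 using 1
    simp [mul_assoc]
  have hset : ∀ x ∈ (quotInNormalizer H K : Set _) ∪ {π ⟨g, hg⟩},
      ∀ y ∈ (quotInNormalizer H K : Set _) ∪ {π ⟨g, hg⟩}, x * y = y * x := by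
    rintro x (hx | rfl) y (hy | rfl)
    · exact hmax.1 x hx y hy
    · exact hcomm x hx
    · exact (hcomm y hy).symm
    · rfl
  have hcl := Subgroup.isMulCommutative_closure hset
  have hle := hmax.2 (y := Subgroup.closure ((quotInNormalizer H K : Set _) ∪ {π ⟨g, hg⟩}))
    (fun x hx y hy => congrArg Subtype.val (hcl.is_comm.comm ⟨x, hx⟩ ⟨y, hy⟩))
    (fun x hx => Subgroup.subset_closure (Or.inl hx))
  exact (mk_mem_quotInNormalizer_iff hKH.1 hg).1
    (hle (Subgroup.subset_closure (Or.inr rfl)))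

end QuotInNormalizer

/-! ### Orthogonality of the conjugates of ε(H,K). -/

section Orthogonality

variable {G : Type*} [Group G] [Finite G] {H K : Subgroup G}

/-- The element u = gkg⁻¹ commutes with ε, and ugε = gkε = gε, so u fixes εgε. -/
theorem epsilonElem_mul_of_mul_epsilonElem_eq_zero {χ : H →* ℂˣ}
    (hχ : ∀ h, χ h = 1 ↔ (h : G) ∈ K) (hKH : NormalIn K H) {g k : G} (hk : k ∈ K)
    (hH : g * k * g⁻¹ ∈ H) (hK : g * k * g⁻¹ ∉ K) :
    epsilonElem H K * (MonoidAlgebra.of ℚ G g * epsilonElem H K) = 0 := by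
  refine eq_zero_of_fixed_of_notMem hχ hKH hH hK ?_ ?_
  · rw [← mul_assoc, epsilonElem_mul_self hKH]
  · rw [← mul_assoc, (of_commute_epsilonElem_of_mem hKH hH).eq, mul_assoc,
      ← mul_assoc (MonoidAlgebra.of ℚ G _), ← map_mul, inv_mul_cancel_right, map_mul, mul_assoc,
      of_mul_epsilonElem hKH hk]

/-- If g normalizes D = K ∩ A, it normalizes H, so gKg⁻¹ ≤ H but gKg⁻¹ is not inside K. Otherwise
some k in D is conjugated out of D; its conjugate stays in A ≤ H, hence leaves K. -/
theorem exists_conj_mem_notMem {A : Subgroup G} (hA : A.Normal) (hAH : A ≤ H)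
    (hKH : NormalIn K H) (hHN : NormalIn H (normalizerOf (K ⊓ A))) {g : G}
    (hg : g ∉ normalizerOf K) : ∃ k ∈ K, g * k * g⁻¹ ∈ H ∧ g * k * g⁻¹ ∉ K := by
  by_contra! hcon
  by_cases hgD : g ∈ normalizerOf (K ⊓ A)
  · exact hg (mem_normalizerOf_of_forall fun k hk =>
      hcon k hk (conj_mem_of_mem_normalizerOf (hHN.le_normalizerOf hgD) (hKH.1 hk)))
  · refine hgD (mem_normalizerOf_of_forall fun k hk => ?_)
    have := hA.conj_mem k hk.2 g
    exact ⟨hcon k hk.1 (hAH this), this⟩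

theorem normalizerOf_le_normalizerOf_inf {A : Subgroup G} (hA : A.Normal) :
    normalizerOf K ≤ normalizerOf (K ⊓ A) := fun g hg =>
  mem_normalizerOf_of_forall fun k hk =>
    ⟨conj_mem_of_mem_normalizerOf hg hk.1, hA.conj_mem k hk.2 g⟩

theorem conjugatesIn_epsilonElem_pairwise (hKH : NormalIn K H)
    (hNH : normalizerOf K ≤ normalizerOf H)
    (horth : ∀ g ∉ normalizerOf K,
      epsilonElem H K * (MonoidAlgebra.of ℚ G g * epsilonElem H K) = 0) :
    (conjugatesIn (epsilonElem H K)).Pairwise fun x y => x * y = 0 := by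
  rintro _ ⟨g, rfl⟩ _ ⟨t, rfl⟩ hne
  by_cases hN : g * t⁻¹ ∈ normalizerOf K
  · refine absurd ?_ hne
    have h := (of_commute_epsilonElem hKH (hNH hN) hN).eq
    have e : MonoidAlgebra.of ℚ G g = MonoidAlgebra.of ℚ G (g * t⁻¹) * MonoidAlgebra.of ℚ G t := by
      rw [← map_mul, inv_mul_cancel_right]
    change MonoidAlgebra.of ℚ G g⁻¹ * epsilonElem H K * MonoidAlgebra.of ℚ G g = _
    rw [e, mul_assoc, ← mul_assoc (epsilonElem H K), ← h, ← mul_assoc, ← mul_assoc, ← map_mul,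
      inv_mul_cancel_left]
  · have h := horth _ hN
    rw [map_mul] at h
    calc _ = MonoidAlgebra.of ℚ G g⁻¹ * (epsilonElem H K * (MonoidAlgebra.of ℚ G g *
          MonoidAlgebra.of ℚ G t⁻¹ * epsilonElem H K)) * MonoidAlgebra.of ℚ G t := by
            simp only [mul_assoc]
      _ = 0 := by rw [h, mul_zero, zero_mul]

end Orthogonality

/-! ### Centrality and primitivity of e(G,H,K). -/

section Primitivity

variable {G : Type*} [Group G] [Finite G] {H K : Subgroup G}

theorem mem_center_monoidAlgebra_iff {G : Type*} [Group G] {e : MonoidAlgebra ℚ G} :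
    e ∈ Subring.center (MonoidAlgebra ℚ G) ↔ ∀ g, Commute (MonoidAlgebra.of ℚ G g) e := by
  rw [Subring.mem_center_iff]
  refine ⟨fun h g => h _, fun h x => ?_⟩
  induction x using MonoidAlgebra.induction_on with
  | of g => exact h g
  | add x y hx hy => rw [add_mul, mul_add, hx, hy]
  | smul r x hx => rw [smul_mul_assoc, mul_smul_comm, hx]

open Classical in
/-- The sum over `h ∈ H` of the conjugates `h (ε y ε) h⁻¹`, with `ε = ε(H,K)`. -/
noncomputable def epsilonTrace (H K : Subgroup G) : MonoidAlgebra ℚ G →ₗ[ℚ] MonoidAlgebra ℚ G :=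
  letI := Fintype.ofFinite H
  ∑ h : H, LinearMap.mulLeft ℚ (MonoidAlgebra.of ℚ G h * epsilonElem H K) ∘ₗ
    LinearMap.mulRight ℚ (epsilonElem H K * MonoidAlgebra.of ℚ G (h : G)⁻¹)

/-- The trace of g vanishes unless g lies in H: outside N_G(K) since εgε = 0, and in N_G(K) \ H
since the commutators of g with H do not all lie in K. -/
theorem epsilonTrace_of_mem_epsilonSpan {χ : H →* ℂˣ} (hχ : ∀ h, χ h = 1 ↔ (h : G) ∈ K)
    (hKH : NormalIn K H) (hNH : normalizerOf K ≤ normalizerOf H)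
    (hcent : ∀ g ∈ normalizerOf K, (∀ h ∈ H, g⁻¹ * h * g * h⁻¹ ∈ K) → g ∈ H)
    (horth : ∀ g ∉ normalizerOf K,
      epsilonElem H K * (MonoidAlgebra.of ℚ G g * epsilonElem H K) = 0) (g : G) :
    epsilonTrace H K (MonoidAlgebra.of ℚ G g) ∈ epsilonSpan H K := by
  let := Fintype.ofFinite H
  have hT : epsilonTrace H K (MonoidAlgebra.of ℚ G g) = ∑ h : H,
      MonoidAlgebra.of ℚ G h * (epsilonElem H K * (MonoidAlgebra.of ℚ G g * epsilonElem H K)) *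
        MonoidAlgebra.of ℚ G (h : G)⁻¹ := by
    simp [epsilonTrace, mul_assoc, -MonoidAlgebra.of_apply]
  rw [hT]
  by_cases hN : g ∈ normalizerOf K
  swap
  · simp only [horth g hN, mul_zero, zero_mul, Finset.sum_const_zero]
    exact Submodule.zero_mem _
  have hterm : ∀ h : H, MonoidAlgebra.of ℚ G h *
      (epsilonElem H K * (MonoidAlgebra.of ℚ G g * epsilonElem H K)) *
        MonoidAlgebra.of ℚ G (h : G)⁻¹ =
      MonoidAlgebra.of ℚ G (h * g * (h : G)⁻¹) * epsilonElem H K := by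
    intro h
    rw [(of_commute_epsilonElem hKH (hNH hN) hN).eq, ← mul_assoc (epsilonElem H K),
      epsilonElem_mul_self hKH, ← (of_commute_epsilonElem hKH (hNH hN) hN).eq,
      mul_assoc, mul_assoc, ← (of_commute_epsilonElem_of_mem hKH (H.inv_mem h.2)).eq]
    simp only [map_mul, mul_assoc]
  rw [Finset.sum_congr rfl fun h _ => hterm h]
  by_cases hgH : g ∈ H
  · exact Submodule.sum_mem _ fun h _ => Submodule.subset_span
      ⟨⟨_, H.mul_mem (H.mul_mem h.2 hgH) (H.inv_mem h.2)⟩, rfl⟩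
  obtain ⟨h₁, h₁H, h₁K⟩ : ∃ h ∈ H, g⁻¹ * h * g * h⁻¹ ∉ K := by
    by_contra! hcon
    exact hgH (hcent g hN hcon)
  have hconj : ∀ h ∈ H, g⁻¹ * h * g ∈ H := fun h hh => by
    simpa using conj_mem_of_mem_normalizerOf (inv_mem (hNH hN)) hh
  have hcm : ∀ h ∈ H, g⁻¹ * h * g * h⁻¹ ∈ H := fun h hh => H.mul_mem (hconj h hh) (H.inv_mem hh)
  set w := ∑ h : H, MonoidAlgebra.of ℚ G (g⁻¹ * h * g * (h : G)⁻¹) * epsilonElem H K with hw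
  have hsum : ∑ h : H, MonoidAlgebra.of ℚ G (h * g * (h : G)⁻¹) * epsilonElem H K =
      MonoidAlgebra.of ℚ G g * w := by
    rw [hw, Finset.mul_sum]
    refine Finset.sum_congr rfl fun h _ => ?_
    rw [← mul_assoc, ← map_mul]
    congr 2
    group
  -- The commutator c = g⁻¹h₁gh₁⁻¹ lies in H \ K and fixes w: modulo K, where H is abelian,
  -- replacing h by h₁h multiplies g⁻¹hgh⁻¹ by c.
  have hw0 : w = 0 := by
    refine eq_zero_of_fixed_of_notMem hχ hKH (hcm h₁ h₁H) h₁K ?_ ?_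
    · rw [hw, Finset.mul_sum]
      refine Finset.sum_congr rfl fun h _ => ?_
      rw [← mul_assoc, ← (of_commute_epsilonElem_of_mem hKH (hcm h h.2)).eq, mul_assoc,
        epsilonElem_mul_self hKH]
    · rw [hw, Finset.mul_sum]
      refine Finset.sum_equiv (Equiv.mulLeft ⟨h₁, h₁H⟩) (fun _ => by simp) fun h _ => ?_
      rw [← mul_assoc, ← map_mul]
      refine of_mul_epsilonElem_eq_of_inv_mul_mem hKH ?_
      convert commutator_mem_of_character hχ (H.inv_mem h₁H) (hcm h h.2) using 1
      simp only [Equiv.coe_mulLeft, Subgroup.coe_mul]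
      group
  rw [hsum, hw0, mul_zero]
  exact Submodule.zero_mem _

/-- For central f every summand of the trace equals fε, so fε is the trace of f divided by |H|. -/
theorem mul_epsilonElem_mem_epsilonSpan {χ : H →* ℂˣ} (hχ : ∀ h, χ h = 1 ↔ (h : G) ∈ K)
    (hKH : NormalIn K H) (hNH : normalizerOf K ≤ normalizerOf H)
    (hcent : ∀ g ∈ normalizerOf K, (∀ h ∈ H, g⁻¹ * h * g * h⁻¹ ∈ K) → g ∈ H)
    (horth : ∀ g ∉ normalizerOf K,
      epsilonElem H K * (MonoidAlgebra.of ℚ G g * epsilonElem H K) = 0)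
    {f : MonoidAlgebra ℚ G} (hf : f ∈ Subring.center (MonoidAlgebra ℚ G)) :
    f * epsilonElem H K ∈ epsilonSpan H K := by
  let := Fintype.ofFinite H
  have hmem : ∀ y, epsilonTrace H K y ∈ epsilonSpan H K := by
    intro y
    induction y using MonoidAlgebra.induction_on with
    | of g => exact epsilonTrace_of_mem_epsilonSpan hχ hKH hNH hcent horth g
    | add x y hx hy => rw [map_add]; exact Submodule.add_mem _ hx hy
    | smul r x hx => rw [map_smul]; exact Submodule.smul_mem _ _ hx
  have hc := Subring.mem_center_iff.1 hf
  have hT : epsilonTrace H K f = (Fintype.card H : ℚ) • (f * epsilonElem H K) := by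
    have : epsilonTrace H K f = ∑ h : H, MonoidAlgebra.of ℚ G h * epsilonElem H K *
        (f * (epsilonElem H K * MonoidAlgebra.of ℚ G (h : G)⁻¹)) := by
      simp [epsilonTrace, mul_assoc, -MonoidAlgebra.of_apply]
    rw [this, Finset.sum_congr rfl (g := fun _ => f * epsilonElem H K), Finset.sum_const,
      Finset.card_univ, Nat.cast_smul_eq_nsmul]
    intro h _
    rw [← mul_assoc, hc, mul_assoc, mul_assoc (MonoidAlgebra.of ℚ G _),
      ← mul_assoc (epsilonElem H K), epsilonElem_mul_self hKH,
      ← (of_commute_epsilonElem_of_mem hKH (H.inv_mem h.2)).eq,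
      ← mul_assoc (MonoidAlgebra.of ℚ G _), ← map_mul, mul_inv_cancel, map_one, one_mul]
  have hcard : (Fintype.card H : ℚ) ≠ 0 := by exact_mod_cast Fintype.card_ne_zero
  have := Submodule.smul_mem _ (Fintype.card H : ℚ)⁻¹ (hmem f)
  rwa [hT, smul_smul, inv_mul_cancel₀ hcard, one_smul] at this

theorem epsilonElem_mem_conjugatesIn : epsilonElem H K ∈ conjugatesIn (epsilonElem H K) :=
  ⟨1, by simp only [inv_one, map_one, one_mul, mul_one]⟩

theorem isIdempotentElem_of_mem_conjugatesIn (hKH : NormalIn K H) {x : MonoidAlgebra ℚ G}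
    (hx : x ∈ conjugatesIn (epsilonElem H K)) : x * x = x := by
  obtain ⟨g, rfl⟩ := hx
  have hg : MonoidAlgebra.of ℚ G g * MonoidAlgebra.of ℚ G g⁻¹ = 1 := by
    rw [← map_mul, mul_inv_cancel, map_one]
  calc _ = MonoidAlgebra.of ℚ G g⁻¹ * (epsilonElem H K * (MonoidAlgebra.of ℚ G g *
        MonoidAlgebra.of ℚ G g⁻¹) * epsilonElem H K) * MonoidAlgebra.of ℚ G g := by
          simp only [mul_assoc]
    _ = _ := by rw [hg, mul_one, epsilonElem_mul_self hKH]

theorem eElem_mul_of_mem_conjugatesIn (hKH : NormalIn K H)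
    (hpair : (conjugatesIn (epsilonElem H K)).Pairwise fun x y => x * y = 0)
    {x : MonoidAlgebra ℚ G} (hx : x ∈ conjugatesIn (epsilonElem H K)) :
    eElem H K * x = x := by
  unfold eElem
  rw [Finset.sum_mul, Finset.sum_eq_single x]
  · exact isIdempotentElem_of_mem_conjugatesIn hKH hx
  · intro y hy hne
    exact hpair (by simpa using hy) hx hne
  · intro h
    exact absurd (by simpa using hx) h

theorem mul_eElem_eq_zero {f : MonoidAlgebra ℚ G}
    (hf : f ∈ Subring.center (MonoidAlgebra ℚ G)) (h : f * epsilonElem H K = 0) :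
    f * eElem H K = 0 := by
  unfold eElem
  rw [Finset.mul_sum]
  refine Finset.sum_eq_zero fun x hx => ?_
  obtain ⟨g, rfl⟩ : x ∈ conjugatesIn (epsilonElem H K) := by simpa using hx
  rw [← mul_assoc, ← mul_assoc, ← Subring.mem_center_iff.1 hf, mul_assoc _ f, h, mul_zero,
    zero_mul]

theorem eElem_mem_center : eElem H K ∈ Subring.center (MonoidAlgebra ℚ G) := by
  rw [mem_center_monoidAlgebra_iff]
  intro g
  have key : ∀ t : G, ∀ x ∈ conjugatesIn (epsilonElem H K),
      MonoidAlgebra.of ℚ G t * x * MonoidAlgebra.of ℚ G t⁻¹ ∈ conjugatesIn (epsilonElem H K) := by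
    rintro t _ ⟨s, rfl⟩
    refine ⟨s * t⁻¹, ?_⟩
    simp only [mul_inv_rev, inv_inv, map_mul, mul_assoc]
  have hg : ∀ t : G, MonoidAlgebra.of ℚ G t⁻¹ * MonoidAlgebra.of ℚ G t = 1 := fun t => by
    rw [← map_mul, inv_mul_cancel, map_one]
  have hg' : ∀ t : G, MonoidAlgebra.of ℚ G t * MonoidAlgebra.of ℚ G t⁻¹ = 1 := fun t => by
    rw [← map_mul, mul_inv_cancel, map_one]
  rw [commute_iff_eq]
  unfold eElem
  rw [Finset.mul_sum, Finset.sum_mul]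
  refine Finset.sum_bij' (fun x _ => MonoidAlgebra.of ℚ G g * x * MonoidAlgebra.of ℚ G g⁻¹)
    (fun x _ => MonoidAlgebra.of ℚ G g⁻¹ * x * MonoidAlgebra.of ℚ G g) ?_ ?_ ?_ ?_ ?_
  · intro x hx
    simpa only [Set.Finite.mem_toFinset] using key g x (by simpa using hx)
  · intro x hx
    simpa only [Set.Finite.mem_toFinset, inv_inv] using key g⁻¹ x (by simpa using hx)
  · intro x _
    rw [mul_assoc, mul_assoc _ _ (MonoidAlgebra.of ℚ G g), hg, mul_one, ← mul_assoc, hg, one_mul]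
  · intro x _
    rw [mul_assoc, mul_assoc _ _ (MonoidAlgebra.of ℚ G g⁻¹), hg', mul_one, ← mul_assoc, hg',
      one_mul]
  · intro x _
    rw [mul_assoc _ _ (MonoidAlgebra.of ℚ G g), hg, mul_one]

theorem isPrimitiveCentralIdempotent_eElem {χ : H →* ℂˣ} (hχ : ∀ h, χ h = 1 ↔ (h : G) ∈ K)
    (hKH : NormalIn K H) (hNH : normalizerOf K ≤ normalizerOf H)
    (hcent : ∀ g ∈ normalizerOf K, (∀ h ∈ H, g⁻¹ * h * g * h⁻¹ ∈ K) → g ∈ H)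
    (horth : ∀ g ∉ normalizerOf K,
      epsilonElem H K * (MonoidAlgebra.of ℚ G g * epsilonElem H K) = 0) :
    IsPrimitiveCentralIdempotent (eElem H K) := by
  have hpair := conjugatesIn_epsilonElem_pairwise hKH hNH horth
  have heε := eElem_mul_of_mem_conjugatesIn hKH hpair epsilonElem_mem_conjugatesIn
  have hidem : eElem H K * eElem H K = eElem H K := by
    conv_lhs => arg 2; unfold eElem
    rw [Finset.mul_sum]
    exact Finset.sum_congr rfl fun x hx =>
      eElem_mul_of_mem_conjugatesIn hKH hpair (by simpa using hx)
  refine ⟨?_, hidem, eElem_mem_center, ?_⟩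
  · intro h0
    rw [h0, zero_mul] at heε
    exact epsilonElem_ne_zero hχ hKH heε.symm
  · intro f g hf hfc hg hgc hfg hsum
    have hfe : f * eElem H K = f := by rw [← hsum, mul_add, hfg, hf.eq, add_zero]
    have hge : g * eElem H K = g := by
      rw [← hsum, mul_add, hg.eq, Subring.mem_center_iff.1 hfc, hfg, zero_add]
    have hsq : f * epsilonElem H K * (f * epsilonElem H K) = f * epsilonElem H K := by
      rw [← mul_assoc, mul_assoc f, Subring.mem_center_iff.1 hfc, ← mul_assoc, hf.eq, mul_assoc,
        epsilonElem_mul_self hKH]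
    rcases eq_zero_or_eq_epsilonElem_of_idempotent hχ hKH
      (mul_epsilonElem_mem_epsilonSpan hχ hKH hNH hcent horth hfc) hsq with h | h
    · left
      rw [← hfe, mul_eElem_eq_zero hfc h]
    · right
      -- Here fε = ε = eε = fε + gε.
      have : g * epsilonElem H K = 0 := by
        rw [← hsum, add_mul, h] at heε
        simpa using heε
      rw [← hge, mul_eElem_eq_zero hgc this]

end Primitivity

theorem corollary5p4 {G : Type*} [Group G] [Finite G] (H K A : Subgroup G)
    (hA : A.Normal) (hAH : A ≤ H)
    (hKH : NormalIn K H) (hHN : NormalIn H (normalizerOf (K ⊓ A)))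
    (hcyc : IsCyclic (quotInNormalizer H K))
    (hmax : IsMaximalAbelian (quotInNormalizer H K)) :
    IsStrongShodaPair H K ∧ IsPrimitiveCentralIdempotent (eElem H K) := by
  obtain ⟨χ, hχ⟩ := exists_character_of_isCyclic hKH hcyc
  have hNH : normalizerOf K ≤ normalizerOf H :=
    (normalizerOf_le_normalizerOf_inf hA).trans hHN.le_normalizerOf
  have horth : ∀ g ∉ normalizerOf K,
      epsilonElem H K * (MonoidAlgebra.of ℚ G g * epsilonElem H K) = 0 := by
    intro g hg
    obtain ⟨k, hk, h1, h2⟩ := exists_conj_mem_notMem hA hAH hKH hHN hg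
    exact epsilonElem_mul_of_mul_epsilonElem_eq_zero hχ hKH hk h1 h2
  refine ⟨⟨hKH, ⟨hKH.le_normalizerOf, ?_⟩, hcyc, hmax,
    conjugatesIn_epsilonElem_pairwise hKH hNH horth⟩, ?_⟩
  · exact (Subgroup.normal_subgroupOf_iff_le_normalizer hKH.le_normalizerOf).2 hNH
  · exact isPrimitiveCentralIdempotent_eElem hχ hKH hNH
      (fun g hg => mem_of_centralizes_mod hKH hmax hg) horth
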